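/- Let $n\ge 1$, let $\pi=(n_1,\dots,n_m)$, $n_r\ge 1$, $n_1+\dots+n_m=n$, be a partition with $m\ge 2$, and let every $n\times n$ complex matrix $X$ carry the corresponding block partition $(X_{rs})_{1\le r,s\le m}$. For a pair $(i,j)$, $i<j$, an elementary block matrix with pivot pair $(i,j)$ is a matrix that agrees with $I_n$ outside the four blocks $(i,i),(i,j),(j,i),(j,j)$, and $\widehat X_{ij}=\begin{bmatrix}X_{ii}&X_{ij}\\X_{ji}&X_{jj}\end{bmatrix}$ is the pivot submatrix of $X$. Let $\mathrm{off}(X)=\|X-\mathrm{diag}(X)\|_F$ be the Frobenius norm of the off-diagonal part of a square matrix $X$. Pivot orderings. A pivot ordering is a sequence in which each element of $\mathcal P_m=\{(r,s):1\le r<s\le m\}$ appears exactly once. Two pivot orderings are equivalent if one is obtained from the other by finitely many transpositions of adjacent terms $(i,j),(i',j')$ with $\{i,j\}\cap\{i',j'\}=\emptyset$; they are shift-equivalent if they have the form $[\mathcal O_1,\mathcal O_2]$ and $[\mathcal O_2,\mathcal O_1]$; weakly equivalent if they are connected by a finite chain of equivalences and shift-equivalences; and permutation equivalent if one is obtained from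 the other by applying a permutation of $\{1,\dots,m\}$ to all indices (each resulting pair being written with its smaller index first). A pivot ordering is serial with permutations if it, or its reverse, either runs through the columns $j=2,3,\dots,m$ in this order, taking the positions $(1,j),\dots,(j-1,j)$ of each column in an arbitrary order, or runs through the rows $i=m-1,m-2,\dots,1$ in this order, taking the positions $(i,i+1),\dots,(i,m)$ of each row in an arbitrary order. A pivot ordering $\mathcal O$ is generalized serial if there are pivot orderings $\mathcal O',\mathcal O''$ with $\mathcal O''$ serial with permutations such that either $\mathcal O$ is permutation equivalent to $\mathcal O'$ and $\mathcal O'$ is weakly equivalent to $\mathcal O''$, or $\mathcal O$ is weakly equivalent to $\mathcal O'$ and $\mathcal O'$ is permutation equivalent to $\mathcal O''$. Let $A\in\mathbb C^{n\times n}$, $A\neq 0$, be Hermitian, and let $(A^{(k)})_{k\ge 0}$ be generated by $$A^{(0)}=A,\qquad A^{(k+1)}=(T^{(k)})^*A^{(k)}T^{(k)}+E^{(k)},\quad k\ge 0,$$ where $E^{(k)}\in\mathbb C^{n\times n}$ and $T^{(k)}$ is a nonsingular elementary block matrix with pivot pair $(i(k),j(k))$. Assume: A1. $(i(k),j(k))_{k\ge0}$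 is the periodic repetition of a generalized serial pivot ordering. A2. There are unitary elementary block matrices $U^{(k)}$ with pivot pairs $(i(k),j(k))$, $k\ge 0$, such that $\lim_{k\to\infty}(T^{(k)}-U^{(k)})=0$. A3. $\liminf_{k\to\infty}\sigma_{\min}\bigl(T^{(k)}_{i(k)i(k)}\bigr)>0$, where $\sigma_{\min}$ is the smallest singular value. If the sequence $(A^{(k)})_{k\ge0}$ is bounded and $\lim_{k\to\infty}\mathrm{off}(E^{(k)})=0$, then $$\lim_{k\to\infty}\mathrm{off}\bigl(\widehat A^{(k+1)}_{i(k)j(k)}\bigr)=0\quad\text{if and only if}\quad\lim_{k\to\infty}\mathrm{off}(A^{(k)})=0 .$$ -/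

import Mathlib

open Filter Topology
open scoped Matrix Matrix.Norms.Frobenius

/-! ### Pivot orderings

`List (Fin m × Fin m)` models finite sequences of pivot positions; the block indices `1, …, m` are
the elements of `Fin m`. -/

/-- Orderings of the set of pivot positions `{(r, s) | r < s}`: every pivot position appears
exactly once, and nothing else appears. -/
def IsPivotOrdering {m : ℕ} (O : List (Fin m × Fin m)) : Prop :=
  O.Nodup ∧ ∀ p : Fin m × Fin m, p ∈ O ↔ p.1 < p.2

/-- `O'` is obtained from `O` by one admissible transposition: two adjacent terms whose index sets
are disjoint are exchanged. -/
def AdmissibleTransposition {m : ℕ} (O O' : List (Fin m × Fin m)) : Prop :=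
  ∃ (L₁ L₂ : List (Fin m × Fin m)) (p q : Fin m × Fin m),
    Disjoint ({p.1, p.2} : Set (Fin m)) {q.1, q.2} ∧
      O = L₁ ++ p :: q :: L₂ ∧ O' = L₁ ++ q :: p :: L₂

/-- Equivalence `O ∼ O'`: finitely many admissible transpositions lead from `O` to `O'`. -/
def OrderingEquiv {m : ℕ} (O O' : List (Fin m × Fin m)) : Prop :=
  Relation.ReflTransGen AdmissibleTransposition O O'

/-- Shift-equivalence: `O = [O₁, O₂]` and `O' = [O₂, O₁]`. -/
def ShiftEquiv {m : ℕ} (O O' : List (Fin m × Fin m)) : Prop :=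
  ∃ O₁ O₂ : List (Fin m × Fin m), O = O₁ ++ O₂ ∧ O' = O₂ ++ O₁

/-- Weak equivalence: a chain `O = O₀, …, O_t = O'`, `t ≥ 1`, of equivalences and
shift-equivalences. All members of the chain are automatically rearrangements of `O`. -/
def WeakEquiv {m : ℕ} (O O' : List (Fin m × Fin m)) : Prop :=
  Relation.TransGen (fun P Q => OrderingEquiv P Q ∨ ShiftEquiv P Q) O O'

/-- Permutation equivalence: `O'` arises from `O` by relabelling the block indices by a
permutation `q`. A pivot position stands for the unordered pair of its indices, so the relabelled
pair `{q i, q j}` is again written with its smaller index first. -/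
def PermEquiv {m : ℕ} (O O' : List (Fin m × Fin m)) : Prop :=
  ∃ q : Equiv.Perm (Fin m),
    O' = O.map fun p => (min (q p.1) (q p.2), max (q p.1) (q p.2))

/-- Column-by-column orderings: for `j = 2, …, m` in increasing order, the positions
`(1, j), …, (j - 1, j)` of column `j` in an arbitrary order, given by the list `τ j`. -/
def IsSerialCol {m : ℕ} (O : List (Fin m × Fin m)) : Prop :=
  ∃ τ : Fin m → List (Fin m),
    (∀ j, (τ j).Nodup ∧ ∀ i, i ∈ τ j ↔ i < j) ∧
      O = (List.finRange m).flatMap fun j => (τ j).map fun i => (i, j)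

/-- Row-by-row orderings: for `i = m - 1, …, 1` in decreasing order, the positions
`(i, i + 1), …, (i, m)` of row `i` in an arbitrary order, given by the list `τ i`. -/
def IsSerialRow {m : ℕ} (O : List (Fin m × Fin m)) : Prop :=
  ∃ τ : Fin m → List (Fin m),
    (∀ i, (τ i).Nodup ∧ ∀ j, j ∈ τ i ↔ i < j) ∧
      O = (List.finRange m).reverse.flatMap fun i => (τ i).map fun j => (i, j)

/-- Serial pivot orderings with permutations: column-by-column orderings, row-by-row orderings, and
the reverses of these. -/
def IsSerialWithPermutations {m : ℕ} (O : List (Fin m × Fin m)) : Prop :=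
  IsSerialCol O ∨ IsSerialCol O.reverse ∨ IsSerialRow O ∨ IsSerialRow O.reverse

/-- Generalized serial pivot orderings. -/
def IsGeneralizedSerial {m : ℕ} (O : List (Fin m × Fin m)) : Prop :=
  IsPivotOrdering O ∧
    ∃ O' O'' : List (Fin m × Fin m), IsSerialWithPermutations O'' ∧
      ((PermEquiv O O' ∧ WeakEquiv O' O'') ∨ (WeakEquiv O O' ∧ PermEquiv O' O''))

/-- `piv k = (i(k), j(k))` is the cyclic pivot strategy defined by the ordering `O`, i.e. the
periodic repetition of `O`. No such strategy exists if `O` is empty, i.e. if `m < 2`. -/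
def IsCyclicStrategy {m : ℕ} (O : List (Fin m × Fin m)) (piv : ℕ → Fin m × Fin m) : Prop :=
  ∀ k, O[k % O.length]? = some (piv k)

/-! ### Block matrices

The partition `π = (n₁, …, n_m)` of `n` with all `n_r ≥ 1` is a `Composition n`, with
`m = π.length` and `n_r = π.blocksFun r`. -/

/-- The block `A_{rs}` of `A`. -/
def matBlock {n : ℕ} (π : Composition n) (A : Matrix (Fin n) (Fin n) ℂ) (r s : Fin π.length) :
    Matrix (Fin (π.blocksFun r)) (Fin (π.blocksFun s)) ℂ :=
  A.submatrix (π.embedding r) (π.embedding s)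

/-- The pivot submatrix of `A` at the pivot pair `p = (i, j)`. -/
def pivotSubmatrix {n : ℕ} (π : Composition n) (A : Matrix (Fin n) (Fin n) ℂ)
    (p : Fin π.length × Fin π.length) :
    Matrix (Fin (π.blocksFun p.1) ⊕ Fin (π.blocksFun p.2))
      (Fin (π.blocksFun p.1) ⊕ Fin (π.blocksFun p.2)) ℂ :=
  Matrix.fromBlocks (matBlock π A p.1 p.1) (matBlock π A p.1 p.2)
    (matBlock π A p.2 p.1) (matBlock π A p.2 p.2)

/-- `T` is an elementary block matrix with pivot pair `p = (i, j)`: outside the blocks at the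
positions `(i,i)`, `(i,j)`, `(j,i)`, `(j,j)` it agrees with the identity matrix. -/
def IsElementaryBlock {n : ℕ} (π : Composition n) (p : Fin π.length × Fin π.length)
    (T : Matrix (Fin n) (Fin n) ℂ) : Prop :=
  ∀ r s : Fin π.length, ¬ ((r = p.1 ∨ r = p.2) ∧ (s = p.1 ∨ s = p.2)) →
    matBlock π T r s = matBlock π 1 r s

/-- The off-norm: the Frobenius norm of the off-diagonal part. -/
noncomputable def offNorm {ι : Type*} [Fintype ι] [DecidableEq ι] (A : Matrix ι ι ℂ) : ℝ :=
  ‖A - Matrix.diagonal A.diag‖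

/-- The smallest singular value of a square matrix of size `p ≥ 1` (the singular values are
listed in decreasing order, starting from index `0`). -/
noncomputable def sigmaMin {p : ℕ} (M : Matrix (Fin p) (Fin p) ℂ) : ℝ :=
  (Matrix.toEuclideanLin M).singularValues (p - 1)

/-! The nontrivial implication is proved by compactness. Let `L` be the limsup of the off-norms,
attained along an ultrafilter, and pass to the limit in a long window of iterates ending at step
`k`. In the limit each step is conjugation by a unitary elementary block matrix, up to diagonal
entries, followed by a pivot submatrix with no off-diagonal part. Unitary conjugation preserves the
Frobenius norm, so the limit off-norms decrease along the window. They are at most `L` and equal `L`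
at its end, hence are constant (`offPart_step`, `step_of_tendsto`).

Constancy is rigid: the pivot submatrix of the off-diagonal part must vanish both before and after
every step. Such chains are the runs of `Run`, and it remains to show that a run over enough cycles
starts at zero (`ForcesZero`).

For a serial ordering the vanishing region grows one block index at a time. Let the blocks with
indices in `l` vanish, and let the pivots be `(i, j)` with `i ∈ l`. For a block row `r ∈ l`, `r ≠
i`, the rotation gives `(bU)_{rj} = b_{ri} U_{ij} + b_{rj} U_{jj} = b_{rj} U_{jj}`. Since `U_{jj}`
is nonsingular, the zero met later at pivot `(r, j)` propagates back to `b_{rj}`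
(`Run.star_col_eq_zero`). Nonsingularity survives in the limit thanks to A3. Equivalences, shifts
and relabellings of orderings preserve `ForcesZero`. -/

/-! ### Block rotations and runs

A partition of the index type `ι` into blocks is given by the block index `c : ι → κ`. -/

section Runs

variable {ι κ : Type*}

/-- The block index `r` occurs in the pair `p`. -/
def InPair (p : κ × κ) (r : κ) : Prop := r = p.1 ∨ r = p.2

/-- The submatrix of `b` formed by the blocks with indices in `S` vanishes. -/
def VanishesOn (c : ι → κ) (S : κ → Prop) (b : Matrix ι ι ℂ) : Prop :=
  ∀ x y, S (c x) → S (c y) → b x y = 0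

/-- All diagonal blocks of `b` vanish. -/
def DiagBlocksVanish (c : ι → κ) (b : Matrix ι ι ℂ) : Prop :=
  ∀ x y, c x = c y → b x y = 0

theorem InPair.swap_iff {p : κ × κ} : InPair p.swap = InPair p := by
  funext r; simp [InPair, or_comm]

variable [DecidableEq ι]

/-- `U` agrees with the identity outside of the pivot submatrix. -/
def IsSupportedOn (c : ι → κ) (p : κ × κ) (U : Matrix ι ι ℂ) : Prop :=
  ∀ x y, ¬ (InPair p (c x) ∧ InPair p (c y)) → U x y = (1 : Matrix ι ι ℂ) x y

theorem IsSupportedOn.conjTranspose {c : ι → κ} {p : κ × κ} {U : Matrix ι ι ℂ}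
    (h : IsSupportedOn c p U) : IsSupportedOn c p Uᴴ := by
  intro x y hxy
  rw [Matrix.conjTranspose_apply, h y x (fun h' => hxy ⟨h'.2, h'.1⟩),
    ← Matrix.conjTranspose_apply, Matrix.conjTranspose_one]

variable [Fintype ι]

/-- Columns outside of the pivot columns are not affected by a multiplication from the right. -/
theorem IsSupportedOn.mul_apply_right {c : ι → κ} {p : κ × κ} {U : Matrix ι ι ℂ}
    (h : IsSupportedOn c p U) (b : Matrix ι ι ℂ) (x : ι) {y : ι} (hy : ¬ InPair p (c y)) :
    (b * U) x y = b x y := by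
  rw [Matrix.mul_apply, Finset.sum_eq_single y]
  · rw [h y y (fun h' => hy h'.2), Matrix.one_apply_eq, mul_one]
  · intro z _ hz
    rw [h z y (fun h' => hy h'.2), Matrix.one_apply_ne hz, mul_zero]
  · simp

theorem IsSupportedOn.mul_apply_left {c : ι → κ} {p : κ × κ} {U : Matrix ι ι ℂ}
    (h : IsSupportedOn c p U) (b : Matrix ι ι ℂ) {x : ι} (y : ι) (hx : ¬ InPair p (c x)) :
    (Uᴴ * b) x y = b x y := by
  rw [Matrix.mul_apply, Finset.sum_eq_single x]
  · rw [h.conjTranspose x x (fun h' => hx h'.1), Matrix.one_apply_eq, one_mul]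
  · intro z _ hz
    rw [h.conjTranspose x z (fun h' => hx h'.1), Matrix.one_apply_ne hz.symm, zero_mul]
  · simp

theorem IsSupportedOn.conj_apply {c : ι → κ} {p : κ × κ} {U : Matrix ι ι ℂ}
    (h : IsSupportedOn c p U) (b : Matrix ι ι ℂ) {x y : ι}
    (hx : ¬ InPair p (c x)) (hy : ¬ InPair p (c y)) : (Uᴴ * b * U) x y = b x y := by
  rw [h.mul_apply_right _ _ hy, h.mul_apply_left _ _ hx]

/-- If the pivot indices lie in `S`, a vanishing submatrix with indices in `S` stays zero. -/
theorem IsSupportedOn.vanishesOn_conj {c : ι → κ} {p : κ × κ} {U b : Matrix ι ι ℂ}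
    (h : IsSupportedOn c p U) {S : κ → Prop} (hp : ∀ r, InPair p r → S r)
    (hb : VanishesOn c S b) : VanishesOn c S (Uᴴ * b * U) := by
  intro x y hx hy
  have out {z w : ι} (hz : ¬ S (c z)) (hw : S (c w)) : U z w = 0 := by
    rw [h z w (fun h' => hz (hp _ h'.1)), Matrix.one_apply_ne (by rintro rfl; exact hz hw)]
  rw [Matrix.mul_apply]
  refine Finset.sum_eq_zero fun z _ => ?_
  by_cases hz : S (c z)
  · rw [Matrix.mul_apply, Finset.sum_eq_zero, zero_mul]
    intro w _
    by_cases hw : S (c w)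
    · rw [hb w z hw hz, mul_zero]
    · rw [Matrix.conjTranspose_apply, out hw hx, star_zero, zero_mul]
  · rw [out hz hy, mul_zero]

/-- `U - 1` and `V - 1` live on disjoint sets of indices, so both of their products vanish. -/
theorem IsSupportedOn.commute {c : ι → κ} {p q : κ × κ} {U V : Matrix ι ι ℂ}
    (hU : IsSupportedOn c p U) (hV : IsSupportedOn c q V)
    (hpq : ∀ r, InPair p r → ¬ InPair q r) : U * V = V * U := by
  have aux {p q : κ × κ} {U V : Matrix ι ι ℂ} (hU : IsSupportedOn c p U)
      (hV : IsSupportedOn c q V) (hpq : ∀ r, InPair p r → ¬ InPair q r) :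
      (U - 1) * (V - 1) = 0 := by
    ext x y
    rw [Matrix.mul_apply]
    refine Finset.sum_eq_zero fun z _ => ?_
    by_cases hz : InPair p (c z)
    · rw [Matrix.sub_apply V, hV z y (fun h' => hpq _ hz h'.1), sub_self, mul_zero]
    · rw [Matrix.sub_apply U, hU x z (fun h' => hz h'.2), sub_self, zero_mul]
  have h₁ := aux hU hV hpq
  have h₂ := aux hV hU (fun r hq hp => hpq r hp hq)
  have : U * V - V * U = (U - 1) * (V - 1) - (V - 1) * (U - 1) := by noncomm_ring
  rw [h₁, h₂, sub_zero] at this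
  exact sub_eq_zero.1 this

theorem conj_unitary_cancel {U : Matrix ι ι ℂ} (hU : U ∈ Matrix.unitaryGroup ι ℂ)
    (b : Matrix ι ι ℂ) : U * (Uᴴ * b * U) * Uᴴ = b := by
  have h : U * Uᴴ = 1 := Matrix.mem_unitaryGroup_iff.1 hU
  calc U * (Uᴴ * b * U) * Uᴴ = (U * Uᴴ) * b * (U * Uᴴ) := by simp only [Matrix.mul_assoc]
    _ = b := by rw [h, one_mul, mul_one]

variable [DecidableEq κ]

/-- Unitary elementary block matrices with nonsingular diagonal pivot blocks. -/
structure IsBlockRotation (c : ι → κ) (p : κ × κ) (U : Matrix ι ι ℂ) : Prop where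
  unitary : U ∈ Matrix.unitaryGroup ι ℂ
  supported : IsSupportedOn c p U
  det_fst : (U.toSquareBlock c p.1).det ≠ 0
  det_snd : (U.toSquareBlock c p.2).det ≠ 0

/-- `b'` is a block rotation of `b`, and both have vanishing pivot submatrices. -/
def RotStep (c : ι → κ) (p : κ × κ) (b b' : Matrix ι ι ℂ) : Prop :=
  ∃ U, IsBlockRotation c p U ∧ b' = Uᴴ * b * U ∧
    VanishesOn c (InPair p) b ∧ VanishesOn c (InPair p) b'

/-- `b'` arises from `b` by consecutive steps with the pivot pairs of a list. -/
def Run (c : ι → κ) : List (κ × κ) → Matrix ι ι ℂ → Matrix ι ι ℂ → Prop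
  | [], b, b' => b = b'
  | p :: O, b, b' => ∃ b₁, RotStep c p b b₁ ∧ Run c O b₁ b'

theorem IsBlockRotation.conjTranspose {c : ι → κ} {p : κ × κ} {U : Matrix ι ι ℂ}
    (h : IsBlockRotation c p U) : IsBlockRotation c p Uᴴ := by
  have key (r : κ) : (Uᴴ.toSquareBlock c r) = (U.toSquareBlock c r)ᴴ := rfl
  refine ⟨?_, h.supported.conjTranspose, ?_, ?_⟩
  · exact Unitary.star_mem h.unitary
  · rw [key, Matrix.det_conjTranspose]; exact star_ne_zero.2 h.det_fst
  · rw [key, Matrix.det_conjTranspose]; exact star_ne_zero.2 h.det_snd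

theorem IsBlockRotation.swap {c : ι → κ} {p : κ × κ} {U : Matrix ι ι ℂ}
    (h : IsBlockRotation c p U) : IsBlockRotation c p.swap U :=
  ⟨h.unitary, by simpa only [IsSupportedOn, InPair.swap_iff] using h.supported,
    h.det_snd, h.det_fst⟩

theorem RotStep.swap {c : ι → κ} {p : κ × κ} {b b' : Matrix ι ι ℂ}
    (h : RotStep c p b b') : RotStep c p.swap b b' := by
  obtain ⟨U, hU, h⟩ := h
  exact ⟨U, hU.swap, by rw [InPair.swap_iff]; exact h⟩

theorem RotStep.symm {c : ι → κ} {p : κ × κ} {b b' : Matrix ι ι ℂ}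
    (h : RotStep c p b b') : RotStep c p b' b := by
  obtain ⟨U, hU, rfl, h₁, h₂⟩ := h
  exact ⟨Uᴴ, hU.conjTranspose,
    by rw [Matrix.conjTranspose_conjTranspose, conj_unitary_cancel hU.unitary], h₂, h₁⟩

theorem RotStep.conjTranspose {c : ι → κ} {p : κ × κ} {b b' : Matrix ι ι ℂ}
    (h : RotStep c p b b') : RotStep c p bᴴ b'ᴴ := by
  obtain ⟨U, hU, rfl, h₁, h₂⟩ := h
  refine ⟨U, hU, ?_, fun x y hx hy => ?_, fun x y hx hy => ?_⟩
  · simp [Matrix.mul_assoc]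
  · rw [Matrix.conjTranspose_apply, h₁ y x hy hx, star_zero]
  · rw [Matrix.conjTranspose_apply, h₂ y x hy hx, star_zero]

/-- The rotations commute, and conjugation by one of them leaves the pivot submatrix of the other
untouched, so the vanishing conditions carry over too. -/
theorem RotStep.comm {c : ι → κ} {p q : κ × κ} {b b₁ b₂ : Matrix ι ι ℂ}
    (hpq : ∀ r, InPair p r → ¬ InPair q r)
    (h₁ : RotStep c p b b₁) (h₂ : RotStep c q b₁ b₂) :
    ∃ b', RotStep c q b b' ∧ RotStep c p b' b₂ := by
  obtain ⟨U, hU, rfl, hb, hb₁⟩ := h₁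
  obtain ⟨V, hV, rfl, hb₁', hb₂⟩ := h₂
  have hqp : ∀ r, InPair q r → ¬ InPair p r := fun r hq hp => hpq r hp hq
  have hcomm := hU.supported.commute hV.supported hpq
  have hcomm' : Vᴴ * Uᴴ = Uᴴ * Vᴴ := by
    rw [← Matrix.conjTranspose_mul, ← Matrix.conjTranspose_mul, hcomm]
  have e : Vᴴ * (Uᴴ * b * U) * V = Uᴴ * (Vᴴ * b * V) * U := by
    calc _ = (Vᴴ * Uᴴ) * b * (U * V) := by simp only [Matrix.mul_assoc]
      _ = (Uᴴ * Vᴴ) * b * (V * U) := by rw [hcomm, hcomm']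
      _ = _ := by simp only [Matrix.mul_assoc]
  refine ⟨Vᴴ * b * V, ⟨V, hV, rfl, fun x y hx hy => ?_, fun x y hx hy => ?_⟩,
    U, hU, e, fun x y hx hy => ?_, fun x y hx hy => ?_⟩
  · rw [← hU.supported.conj_apply b (hqp _ hx) (hqp _ hy), hb₁' x y hx hy]
  · rw [← hU.supported.conj_apply (Vᴴ * b * V) (hqp _ hx) (hqp _ hy), ← e, hb₂ x y hx hy]
  · rw [hV.supported.conj_apply b (hpq _ hx) (hpq _ hy), hb x y hx hy]
  · rw [hV.supported.conj_apply _ (hpq _ hx) (hpq _ hy), hb₁ x y hx hy]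

theorem RotStep.eq_zero_iff {c : ι → κ} {p : κ × κ} {b b' : Matrix ι ι ℂ}
    (h : RotStep c p b b') : b = 0 ↔ b' = 0 := by
  have aux {b b' : Matrix ι ι ℂ} (h : RotStep c p b b') : b = 0 → b' = 0 := by
    rintro rfl
    obtain ⟨U, -, rfl, -⟩ := h
    simp
  exact ⟨aux h, aux h.symm⟩

/-- Diagonal blocks in the pivot submatrix vanish by the definition of a step; the others do not
change. -/
theorem RotStep.diagBlocksVanish_iff {c : ι → κ} {p : κ × κ} {b b' : Matrix ι ι ℂ}
    (h : RotStep c p b b') : DiagBlocksVanish c b ↔ DiagBlocksVanish c b' := by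
  have aux {b b' : Matrix ι ι ℂ} (h : RotStep c p b b') :
      DiagBlocksVanish c b → DiagBlocksVanish c b' := by
    intro hb x y hxy
    obtain ⟨U, hU, rfl, -, hb'⟩ := h
    by_cases hx : InPair p (c x)
    · exact hb' x y hx (hxy ▸ hx)
    · rw [hU.supported.conj_apply _ hx (hxy ▸ hx), hb x y hxy]
  exact ⟨aux h, aux h.symm⟩

theorem run_append {c : ι → κ} {O₁ O₂ : List (κ × κ)} {b b' : Matrix ι ι ℂ} :
    Run c (O₁ ++ O₂) b b' ↔ ∃ b₁, Run c O₁ b b₁ ∧ Run c O₂ b₁ b' := by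
  induction O₁ generalizing b with
  | nil => simp [Run]
  | cons p O ih =>
    simp only [List.cons_append, Run, ih]
    constructor
    · rintro ⟨b₁, h, b₂, h', h''⟩; exact ⟨b₂, ⟨b₁, h, h'⟩, h''⟩
    · rintro ⟨b₂, ⟨b₁, h, h'⟩, h''⟩; exact ⟨b₁, h, b₂, h', h''⟩

theorem Run.reverse {c : ι → κ} {O : List (κ × κ)} {b b' : Matrix ι ι ℂ}
    (h : Run c O b b') : Run c O.reverse b' b := by
  induction O generalizing b with
  | nil => exact Eq.symm h
  | cons p O ih =>
    obtain ⟨b₁, h₁, h₂⟩ := h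
    rw [List.reverse_cons, run_append]
    exact ⟨b₁, ih h₂, b, h₁.symm, rfl⟩

theorem Run.conjTranspose {c : ι → κ} {O : List (κ × κ)} {b b' : Matrix ι ι ℂ}
    (h : Run c O b b') : Run c O bᴴ b'ᴴ := by
  induction O generalizing b with
  | nil => exact congrArg _ h
  | cons p O ih =>
    obtain ⟨b₁, h₁, h₂⟩ := h
    exact ⟨_, h₁.conjTranspose, ih h₂⟩

theorem Run.map_swap {c : ι → κ} {O : List (κ × κ)} {b b' : Matrix ι ι ℂ}
    (h : Run c O b b') : Run c (O.map Prod.swap) b b' := by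
  induction O generalizing b with
  | nil => exact h
  | cons p O ih =>
    obtain ⟨b₁, h₁, h₂⟩ := h
    exact ⟨_, h₁.swap, ih h₂⟩

theorem Run.eq_zero_iff {c : ι → κ} {O : List (κ × κ)} {b b' : Matrix ι ι ℂ}
    (h : Run c O b b') : b = 0 ↔ b' = 0 := by
  induction O generalizing b with
  | nil => rw [show b = b' from h]
  | cons p O ih =>
    obtain ⟨b₁, h₁, h₂⟩ := h
    rw [h₁.eq_zero_iff, ih h₂]

theorem Run.diagBlocksVanish_iff {c : ι → κ} {O : List (κ × κ)} {b b' : Matrix ι ι ℂ}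
    (h : Run c O b b') : DiagBlocksVanish c b ↔ DiagBlocksVanish c b' := by
  induction O generalizing b with
  | nil => rw [show b = b' from h]
  | cons p O ih =>
    obtain ⟨b₁, h₁, h₂⟩ := h
    rw [h₁.diagBlocksVanish_iff, ih h₂]

/-- A diagonal block with an index occurring among the pivot pairs of a run vanishes. -/
theorem Run.diagBlock_eq_zero {c : ι → κ} {O : List (κ × κ)} {b b' : Matrix ι ι ℂ}
    (h : Run c O b b') {r : κ} (hr : ∃ p ∈ O, InPair p r) {x y : ι} (hx : c x = r) (hy : c y = r) :
    b x y = 0 := by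
  induction O generalizing b with
  | nil => simp at hr
  | cons p O ih =>
    obtain ⟨b₁, ⟨U, hU, rfl, hb, -⟩, h₂⟩ := h
    by_cases hp : InPair p r
    · exact hb x y (hx ▸ hp) (hy ▸ hp)
    -- Until `r` first occurs in a pivot pair its diagonal block is constant, and at that moment it
    -- is zero.
    · rw [← hU.supported.conj_apply b (hx ▸ hp) (hy ▸ hp)]
      refine ih h₂ ?_
      obtain ⟨q, hq, hqr⟩ := hr
      rcases List.mem_cons.1 hq with rfl | hq
      · exact absurd hqr hp
      · exact ⟨q, hq, hqr⟩

theorem Run.vanishesOn {c : ι → κ} {O : List (κ × κ)} {b b' : Matrix ι ι ℂ}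
    (h : Run c O b b') {S : κ → Prop} (hO : ∀ p ∈ O, ∀ r, InPair p r → S r)
    (hb : VanishesOn c S b) : VanishesOn c S b' := by
  induction O generalizing b with
  | nil => rwa [← show b = b' from h]
  | cons p O ih =>
    obtain ⟨b₁, ⟨U, hU, rfl, -, -⟩, h₂⟩ := h
    exact ih h₂ (fun q hq => hO q (List.mem_cons_of_mem _ hq))
      (hU.supported.vanishesOn_conj (hO p List.mem_cons_self) hb)

theorem eq_zero_of_sum_block_eq_zero {c : ι → κ} {j : κ} {U : Matrix ι ι ℂ}
    (hU : (U.toSquareBlock c j).det ≠ 0) {w : ι → ℂ}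
    (hw : ∀ y, c y = j → ∑ z with c z = j, w z * U z y = 0) {y : ι} (hy : c y = j) : w y = 0 := by
  by_contra hne
  refine hU (Matrix.exists_vecMul_eq_zero_iff.1
    ⟨fun z => w z, fun h => hne (congrFun h ⟨y, hy⟩), ?_⟩)
  funext x
  have h := hw x x.2
  rwa [Finset.sum_subtype (p := fun z => c z = j) _ (by simp)] at h

/-- A run with the pivot pairs `(i, j)`, `i ∈ l`, forces the blocks `(i, j)`, `i ∈ l`, to vanish,
if the blocks with both indices in `l` vanish. -/
theorem Run.star_col_eq_zero {c : ι → κ} {j : κ} {l : List κ} (hl : l.Nodup) (hj : j ∉ l)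
    {b b' : Matrix ι ι ℂ} (h : Run c (l.map fun i => (i, j)) b b')
    (hb : VanishesOn c (· ∈ l) b) {x y : ι} (hx : c x ∈ l) (hy : c y = j) : b x y = 0 := by
  induction l generalizing b x y with
  | nil => simp at hx
  | cons i l ih =>
    obtain ⟨b₁, ⟨U, hU, rfl, hb₀, -⟩, h₂⟩ := h
    have hil : i ∉ l := (List.nodup_cons.1 hl).1
    have hjl : j ∉ l := fun h => hj (List.mem_cons_of_mem _ h)
    have notIn {r : κ} (hr : r ∈ l) : ¬ InPair (i, j) r := by
      rintro (rfl | rfl)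
      exacts [hil hr, hjl hr]
    rcases List.mem_cons.1 hx with hxi | hxl
    · exact hb₀ x y (Or.inl hxi) (Or.inr hy)
    -- Row `x` lies outside the pivot rows, so the induction hypothesis for `Uᴴ * b * U` is a
    -- statement about `b * U`.
    have key : ∀ y, c y = j → (b * U) x y = 0 := by
      intro y hy
      have := ih (List.nodup_cons.1 hl).2 hjl h₂ (x := x) (y := y) ?_ hxl hy
      · rwa [Matrix.mul_assoc, hU.supported.mul_apply_left _ _ (notIn hxl)] at this
      · intro z w hz hw
        rw [hU.supported.conj_apply b (notIn hz) (notIn hw)]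
        exact hb z w (List.mem_cons_of_mem _ hz) (List.mem_cons_of_mem _ hw)
    -- In `(b * U) x y` the terms from block `i` vanish by `hb`, which leaves row `x` of `b` on
    -- block `j` times the nonsingular `U_{jj}`.
    refine eq_zero_of_sum_block_eq_zero hU.det_snd (w := b x) (fun y hy => ?_) hy
    rw [← key y hy, Matrix.mul_apply]
    refine Finset.sum_subset (Finset.filter_subset _ _) fun z _ hz => ?_
    have hzj : c z ≠ j := fun h' => hz (by simp [h'])
    by_cases hzi : c z = i
    · rw [hb x z (List.mem_cons_of_mem _ hxl) (hzi ▸ List.mem_cons_self), zero_mul]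
    · rw [hU.supported z y (fun h' => h'.1.elim hzi hzj),
        Matrix.one_apply_ne (by rintro rfl; exact hzj hy), mul_zero]

end Runs

/-! ### Generalized serial orderings force runs to be zero. -/

section Orderings

variable {ι κ : Type*} [DecidableEq ι] [Fintype ι] [DecidableEq κ]

/-- The enlarged submatrix is already zero in `b`, and pivots inside it keep it zero. Its blocks
`(j, i)` are handled through `bᴴ`, which admits the same pivot list. -/
theorem Run.star_vanishesOn {c : ι → κ} {j : κ} {l : List κ} (hl : l.Nodup) (hj : j ∉ l)
    {b b' : Matrix ι ι ℂ} (h : Run c (l.map fun i => (i, j)) b b')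
    (hb : VanishesOn c (· ∈ l) b) (hd : DiagBlocksVanish c b) :
    VanishesOn c (fun r => r = j ∨ r ∈ l) b' := by
  refine h.vanishesOn ?_ fun x y hx hy => ?_
  · intro p hp r hr
    obtain ⟨i, hi, rfl⟩ := List.mem_map.1 hp
    exact hr.elim (fun h => Or.inr (h ▸ hi)) Or.inl
  · rcases hx with hx | hx <;> rcases hy with hy | hy
    · exact hd x y (hx.trans hy.symm)
    · have hb' : VanishesOn c (· ∈ l) bᴴ := fun z w hz hw => by
        rw [Matrix.conjTranspose_apply, hb w z hw hz, star_zero]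
      have := h.conjTranspose.star_col_eq_zero hl hj hb' hy hx
      rwa [Matrix.conjTranspose_apply, star_eq_zero] at this
    · exact h.star_col_eq_zero hl hj hb hx hy
    · exact hb x y hx hy

/-- Runs through the stars `{(i, j) | r i j}`, where `j` passes through a final segment of the
strict linear order `r` in increasing order. -/
theorem Run.serial_eq_zero {r : κ → κ → Prop} (tri : ∀ i j, i ≠ j → r i j ∨ r j i)
    (asymm : ∀ i j, r i j → ¬ r j i) {c : ι → κ} {τ : κ → List κ}
    (hτ : ∀ j, (τ j).Nodup ∧ ∀ i, i ∈ τ j ↔ r i j) {vs : List κ} (hvs : vs.Pairwise r)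
    (hup : ∀ j ∈ vs, ∀ k, r j k → k ∈ vs) {b b' : Matrix ι ι ℂ}
    (h : Run c (vs.flatMap fun j => (τ j).map fun i => (i, j)) b b')
    (hd : DiagBlocksVanish c b) (hb : VanishesOn c (· ∉ vs) b) : b' = 0 := by
  induction vs generalizing b with
  | nil =>
    rw [← show b = b' from h]
    ext x y
    exact hb x y (by simp) (by simp)
  | cons j vs ih =>
    rw [List.flatMap_cons, run_append] at h
    obtain ⟨b₁, h₁, h₂⟩ := h
    have irr : ¬ r j j := fun h => asymm _ _ h h
    have hjvs : j ∉ vs := fun h => irr ((List.pairwise_cons.1 hvs).1 j h)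
    -- As `j :: vs` is a final segment, the indices already processed are exactly those of the star
    -- at `j`.
    have hout (i : κ) : i ∉ j :: vs ↔ i ∈ τ j := by
      rw [(hτ j).2]
      refine ⟨fun hi => ?_, fun hi hmem => ?_⟩
      · have hne : i ≠ j := fun h => hi (h ▸ List.mem_cons_self)
        exact (tri i j hne).resolve_right fun h => hi (hup j List.mem_cons_self i h)
      · rcases List.mem_cons.1 hmem with rfl | hmem
        · exact irr hi
        · exact asymm _ _ hi ((List.pairwise_cons.1 hvs).1 i hmem)
    refine ih (List.pairwise_cons.1 hvs).2 (fun k hk l hkl => ?_) h₂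
      (h₁.diagBlocksVanish_iff.1 hd) ?_
    · rcases List.mem_cons.1 (hup k (List.mem_cons_of_mem _ hk) l hkl) with rfl | hl
      · exact absurd hkl (asymm _ _ ((List.pairwise_cons.1 hvs).1 k hk))
      · exact hl
    · have hj : j ∉ τ j := fun h => irr (((hτ j).2 j).1 h)
      have := h₁.star_vanishesOn (hτ j).1 hj
        (fun x y hx hy => hb x y ((hout _).2 hx) ((hout _).2 hy)) hd
      have hcov : ∀ i, i ∉ vs → i = j ∨ i ∈ τ j := fun i hi => by
        by_cases hij : i = j
        · exact Or.inl hij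
        · exact Or.inr ((hout i).1 fun h => (List.mem_cons.1 h).elim hij hi)
      exact fun x y hx hy => this x y (hcov _ hx) (hcov _ hy)

/-- Sufficiently many repetitions of the pivot ordering `O` admit only runs of zero matrices. -/
def ForcesZero (ι : Type*) [DecidableEq ι] [Fintype ι] (O : List (κ × κ)) : Prop :=
  ∃ t : ℕ, ∀ (c : ι → κ) (b b' : Matrix ι ι ℂ), DiagBlocksVanish c b →
    Run c (List.replicate t O).flatten b b' → b = 0

theorem forcesZero_of_run {O : List (κ × κ)}
    (h : ∀ (c : ι → κ) (b b' : Matrix ι ι ℂ), DiagBlocksVanish c b → Run c O b b' → b' = 0) :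
    ForcesZero ι O :=
  ⟨1, fun c b b' hd hr => by
    have hr : Run c O b b' := by simpa using hr
    exact hr.eq_zero_iff.2 (h c b b' hd hr)⟩

/-- Steps are invertible, so a run can be read backwards from `b'` to `b`. -/
theorem forcesZero_of_run_reverse {O : List (κ × κ)}
    (h : ∀ (c : ι → κ) (b b' : Matrix ι ι ℂ), DiagBlocksVanish c b → Run c O.reverse b b' → b' = 0) :
    ForcesZero ι O :=
  ⟨1, fun c b b' hd hr => by
    have hr : Run c O b b' := by simpa using hr
    exact h c b' b (hr.diagBlocksVanish_iff.1 hd) hr.reverse⟩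

theorem IsSerialCol.eq_zero {m : ℕ} {O : List (Fin m × Fin m)} (hO : IsSerialCol O)
    {c : ι → Fin m} {b b' : Matrix ι ι ℂ} (hd : DiagBlocksVanish c b) (h : Run c O b b') :
    b' = 0 := by
  obtain ⟨τ, hτ, rfl⟩ := hO
  exact h.serial_eq_zero (r := (· < ·)) (fun i j => lt_or_gt_of_ne) (fun i j => lt_asymm) hτ
    (List.pairwise_lt_finRange m) (fun _ _ k _ => List.mem_finRange k) hd
    (fun x _ hx => absurd (List.mem_finRange _) hx)

theorem IsSerialRow.eq_zero {m : ℕ} {O : List (Fin m × Fin m)} (hO : IsSerialRow O)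
    {c : ι → Fin m} {b b' : Matrix ι ι ℂ} (hd : DiagBlocksVanish c b) (h : Run c O b b') :
    b' = 0 := by
  obtain ⟨τ, hτ, rfl⟩ := hO
  -- With the pairs swapped, a row ordering is a column ordering for the reversed order.
  have h := h.map_swap
  rw [List.map_flatMap] at h
  simp only [List.map_map, Function.comp_def, Prod.swap_prod_mk] at h
  exact h.serial_eq_zero (r := (· > ·)) (fun i j hij => (lt_or_gt_of_ne hij).symm)
    (fun i j => lt_asymm) hτ
    (List.pairwise_reverse.2 (List.pairwise_lt_finRange m))
    (fun _ _ k _ => List.mem_reverse.2 (List.mem_finRange k)) hd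
    (fun x _ hx => absurd (List.mem_reverse.2 (List.mem_finRange _)) hx)

theorem IsSerialWithPermutations.forcesZero {m : ℕ} {O : List (Fin m × Fin m)}
    (hO : IsSerialWithPermutations O) : ForcesZero ι O := by
  rcases hO with h | h | h | h
  · exact forcesZero_of_run fun _ _ _ => h.eq_zero
  · exact forcesZero_of_run_reverse fun _ _ _ => h.eq_zero
  · exact forcesZero_of_run fun _ _ _ => h.eq_zero
  · exact forcesZero_of_run_reverse fun _ _ _ => h.eq_zero

theorem run_replicate_mono {c c' : ι → κ} {O O' : List (κ × κ)}
    (h : ∀ b b' : Matrix ι ι ℂ, Run c O b b' → Run c' O' b b') (t : ℕ) {b b' : Matrix ι ι ℂ}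
    (hr : Run c (List.replicate t O).flatten b b') :
    Run c' (List.replicate t O').flatten b b' := by
  induction t generalizing b with
  | zero => simpa [Run] using hr
  | succ t ih =>
    rw [List.replicate_succ, List.flatten_cons, run_append] at hr ⊢
    obtain ⟨b₁, h₁, h₂⟩ := hr
    exact ⟨b₁, h _ _ h₁, ih h₂⟩

theorem AdmissibleTransposition.run {m : ℕ} {O O' : List (Fin m × Fin m)}
    (h : AdmissibleTransposition O O') {c : ι → Fin m} {b b' : Matrix ι ι ℂ}
    (hr : Run c O b b') : Run c O' b b' := by
  obtain ⟨L₁, L₂, p, q, hpq, rfl, rfl⟩ := h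
  rw [run_append] at hr ⊢
  obtain ⟨b₁, h₁, b₂, hp, b₃, hq, h₂⟩ := hr
  obtain ⟨b₄, hq', hp'⟩ := hp.comm (fun r hr hr' => Set.disjoint_left.1 hpq hr hr') hq
  exact ⟨b₁, h₁, b₄, hq', b₃, hp', h₂⟩

theorem OrderingEquiv.forcesZero {m : ℕ} {O O' : List (Fin m × Fin m)}
    (h : OrderingEquiv O O') (hO : ForcesZero ι O') : ForcesZero ι O := by
  have hr : ∀ (c : ι → Fin m) (b b' : Matrix ι ι ℂ), Run c O b b' → Run c O' b b' := by
    clear hO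
    intro c b b' hr
    induction h with
    | refl => exact hr
    | tail _ h ih => exact h.run ih
  obtain ⟨t, ht⟩ := hO
  exact ⟨t, fun c b b' hd hb => ht c b b' hd (run_replicate_mono (hr c) t hb)⟩

/-- A shift of the ordering thus costs only one additional cycle in `ForcesZero`. -/
theorem flatten_replicate_shift {α : Type*} (l₁ l₂ : List α) (t : ℕ) :
    (List.replicate (t + 1) (l₁ ++ l₂)).flatten =
      l₁ ++ ((List.replicate t (l₂ ++ l₁)).flatten ++ l₂) := by
  induction t with
  | zero => simp
  | succ t ih => rw [List.replicate_succ, List.flatten_cons, ih]; simp [List.replicate_succ]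

theorem ShiftEquiv.forcesZero {m : ℕ} {O O' : List (Fin m × Fin m)}
    (h : ShiftEquiv O O') (hO : ForcesZero ι O') : ForcesZero ι O := by
  obtain ⟨O₁, O₂, rfl, rfl⟩ := h
  obtain ⟨t, ht⟩ := hO
  refine ⟨t + 1, fun c b b' hd hr => ?_⟩
  rw [flatten_replicate_shift, run_append] at hr
  obtain ⟨b₁, h₁, h₂⟩ := hr
  obtain ⟨b₂, h₂, -⟩ := run_append.1 h₂
  exact h₁.eq_zero_iff.2 (ht c b₁ b₂ (h₁.diagBlocksVanish_iff.1 hd) h₂)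

theorem WeakEquiv.forcesZero {m : ℕ} {O O' : List (Fin m × Fin m)}
    (h : WeakEquiv O O') (hO : ForcesZero ι O') : ForcesZero ι O := by
  have step {P Q : List (Fin m × Fin m)} (h : OrderingEquiv P Q ∨ ShiftEquiv P Q)
      (hQ : ForcesZero ι Q) : ForcesZero ι P := h.elim (·.forcesZero hQ) (·.forcesZero hQ)
  induction h with
  | single h => exact step h hO
  | tail _ h ih => exact ih (step h hO)

/-- Runs are compatible with a relabelling of the block indices. -/
theorem RotStep.relabel {c : ι → κ} {p : κ × κ} {b b' : Matrix ι ι ℂ} (q : Equiv.Perm κ)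
    (h : RotStep c p b b') : RotStep (q ∘ c) (q p.1, q p.2) b b' := by
  obtain ⟨U, hU, rfl, h₁, h₂⟩ := h
  have hin (r : κ) : InPair (q p.1, q p.2) (q r) ↔ InPair p r := by simp [InPair]
  have hdet (r : κ) : (U.toSquareBlock (q ∘ c) (q r)).det = (U.toSquareBlock c r).det :=
    Matrix.equiv_block_det U (fun x => by simp)
  refine ⟨U, ⟨hU.unitary, fun x y hxy => hU.supported x y fun h => hxy ?_, ?_, ?_⟩, rfl,
    fun x y hx hy => h₁ x y ((hin _).1 hx) ((hin _).1 hy),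
    fun x y hx hy => h₂ x y ((hin _).1 hx) ((hin _).1 hy)⟩
  · exact ⟨(hin _).2 h.1, (hin _).2 h.2⟩
  · rw [hdet]; exact hU.det_fst
  · rw [hdet]; exact hU.det_snd

/-- `ForcesZero` quantifies over all block index maps `c`, so the permutation is absorbed by passing
to `q ∘ c`; pairs whose order is reversed are swapped back. -/
theorem PermEquiv.forcesZero {m : ℕ} {O O' : List (Fin m × Fin m)}
    (h : PermEquiv O O') (hO : ForcesZero ι O') : ForcesZero ι O := by
  obtain ⟨q, rfl⟩ := h
  obtain ⟨t, ht⟩ := hO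
  refine ⟨t, fun c b b' hd hr => ht (q ∘ c) b b' (fun x y hxy => hd x y (q.injective hxy))
    (run_replicate_mono (fun b b' hb => ?_) t hr)⟩
  clear hr hd ht
  induction O generalizing b with
  | nil => exact hb
  | cons p O ih =>
    obtain ⟨b₁, h₁, h₂⟩ := hb
    refine ⟨b₁, ?_, ih b₁ h₂⟩
    rcases le_total (q p.1) (q p.2) with h | h
    · simp only [min_eq_left h, max_eq_right h]; exact h₁.relabel q
    · simp only [min_eq_right h, max_eq_left h]; exact (h₁.relabel q).swap

theorem IsGeneralizedSerial.forcesZero {m : ℕ} {O : List (Fin m × Fin m)}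
    (hO : IsGeneralizedSerial O) : ForcesZero ι O := by
  obtain ⟨-, O', O'', hs, ⟨h₁, h₂⟩ | ⟨h₁, h₂⟩⟩ := hO
  · exact h₁.forcesZero (h₂.forcesZero hs.forcesZero)
  · exact h₁.forcesZero (h₂.forcesZero hs.forcesZero)

end Orderings

/-! ### Frobenius norm, off-norm and the rigidity of limit steps. -/

section Frobenius

/-- The off-diagonal part of a square matrix. -/
def offPart {ι : Type*} [DecidableEq ι] (M : Matrix ι ι ℂ) : Matrix ι ι ℂ := M - Matrix.diagonal M.diag

theorem offPart_apply {ι : Type*} [DecidableEq ι] (M : Matrix ι ι ℂ) (x y : ι) :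
    offPart M x y = if x = y then 0 else M x y := by
  rw [offPart, Matrix.sub_apply]
  split_ifs with h
  · rw [h, Matrix.diagonal_apply_eq, Matrix.diag_apply, sub_self]
  · rw [Matrix.diagonal_apply_ne _ h, sub_zero]

variable {ι : Type*} [Fintype ι]

theorem frobenius_norm_sq {ι' : Type*} [Fintype ι'] (M : Matrix ι ι' ℂ) :
    ‖M‖ ^ 2 = ∑ x, ∑ y, ‖M x y‖ ^ 2 := by
  rw [Matrix.frobenius_norm_def, ← Real.rpow_natCast, ← Real.rpow_mul]
  · norm_num
  · positivity

theorem norm_entry_le_frobenius_norm (M : Matrix ι ι ℂ) (x y : ι) : ‖M x y‖ ≤ ‖M‖ := by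
  refine le_of_sq_le_sq ?_ (norm_nonneg _)
  rw [frobenius_norm_sq]
  exact (Finset.single_le_sum (f := fun y => ‖M x y‖ ^ 2) (fun _ _ => by positivity)
    (Finset.mem_univ y)).trans (Finset.single_le_sum (f := fun x => ∑ y, ‖M x y‖ ^ 2)
      (fun _ _ => by positivity) (Finset.mem_univ x))

theorem frobenius_norm_sq_eq_trace (M : Matrix ι ι ℂ) :
    ((‖M‖ ^ 2 : ℝ) : ℂ) = (M * Mᴴ).trace := by
  rw [frobenius_norm_sq, Matrix.trace]
  push_cast
  refine Finset.sum_congr rfl fun x _ => ?_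
  rw [Matrix.diag_apply, Matrix.mul_apply]
  refine Finset.sum_congr rfl fun y _ => ?_
  rw [Matrix.conjTranspose_apply, Complex.star_def, Complex.mul_conj, Complex.normSq_eq_norm_sq]
  push_cast; rfl

theorem frobenius_norm_unitary_conj [DecidableEq ι] {U : Matrix ι ι ℂ}
    (hU : U ∈ Matrix.unitaryGroup ι ℂ) (M : Matrix ι ι ℂ) : ‖Uᴴ * M * U‖ = ‖M‖ := by
  have h : U * Uᴴ = 1 := Matrix.mem_unitaryGroup_iff.1 hU
  have : ((‖Uᴴ * M * U‖ ^ 2 : ℝ) : ℂ) = ((‖M‖ ^ 2 : ℝ) : ℂ) := by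
    rw [frobenius_norm_sq_eq_trace, frobenius_norm_sq_eq_trace]
    calc (Uᴴ * M * U * (Uᴴ * M * U)ᴴ).trace = (Uᴴ * (M * (U * Uᴴ) * Mᴴ * U)).trace := by
          simp only [Matrix.conjTranspose_mul, Matrix.conjTranspose_conjTranspose,
            Matrix.mul_assoc]
      _ = (M * (U * Uᴴ) * Mᴴ * (U * Uᴴ)).trace := by
          rw [Matrix.trace_mul_comm, Matrix.mul_assoc _ U]
      _ = (M * Mᴴ).trace := by rw [h, mul_one, mul_one]
  exact (sq_eq_sq₀ (norm_nonneg _) (norm_nonneg _)).1 (Complex.ofReal_injective this)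

/-- The effect on the norm of replacing some of the entries with zeros. -/
theorem frobenius_norm_zeroing {M N : Matrix ι ι ℂ} {P : ι → ι → Prop}
    (h₀ : ∀ x y, P x y → N x y = 0) (h₁ : ∀ x y, ¬ P x y → N x y = M x y) :
    ‖N‖ ≤ ‖M‖ ∧ (‖N‖ = ‖M‖ → ∀ x y, P x y → M x y = 0) := by
  have hle : ∀ x y, ‖N x y‖ ^ 2 ≤ ‖M x y‖ ^ 2 := fun x y => by
    by_cases h : P x y
    · rw [h₀ x y h, norm_zero, zero_pow two_ne_zero]; positivity
    · rw [h₁ x y h]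
  constructor
  · refine le_of_sq_le_sq ?_ (norm_nonneg _)
    rw [frobenius_norm_sq, frobenius_norm_sq]
    exact Finset.sum_le_sum fun x _ => Finset.sum_le_sum fun y _ => hle x y
  · intro h x y hxy
    have h : ‖N‖ ^ 2 = ‖M‖ ^ 2 := by rw [h]
    rw [frobenius_norm_sq, frobenius_norm_sq,
      Finset.sum_eq_sum_iff_of_le fun x _ => Finset.sum_le_sum fun y _ => hle x y] at h
    have h := (Finset.sum_eq_sum_iff_of_le fun y _ => hle x y).1 (h x (Finset.mem_univ x)) y
      (Finset.mem_univ y)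
    rw [h₀ x y hxy, norm_zero, zero_pow two_ne_zero] at h
    simpa using h.symm

variable [DecidableEq ι]

theorem offNorm_eq (M : Matrix ι ι ℂ) : offNorm M = ‖offPart M‖ := rfl

theorem continuous_offNorm : Continuous (offNorm : Matrix ι ι ℂ → ℝ) := by
  unfold offNorm
  refine continuous_norm.comp (continuous_id.sub ?_)
  exact continuous_id.matrix_diag.matrix_diagonal

theorem offNorm_nonneg (M : Matrix ι ι ℂ) : 0 ≤ offNorm M := norm_nonneg _

theorem norm_entry_le_offNorm (M : Matrix ι ι ℂ) {x y : ι} (h : x ≠ y) :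
    ‖M x y‖ ≤ offNorm M := by
  have := norm_entry_le_frobenius_norm (offPart M) x y
  rwa [offPart_apply, if_neg h] at this

theorem offNorm_le_norm (M : Matrix ι ι ℂ) : offNorm M ≤ ‖M‖ :=
  (frobenius_norm_zeroing (N := offPart M) (P := fun x y => x = y) (fun x y h => by rw [offPart_apply, if_pos h])
    (fun x y h => by rw [offPart_apply, if_neg h])).1

theorem offNorm_submatrix_le {ι' : Type*} [Fintype ι'] [DecidableEq ι'] (M : Matrix ι ι ℂ)
    {e : ι' → ι} (he : Function.Injective e) : offNorm (M.submatrix e e) ≤ offNorm M := by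
  refine le_of_sq_le_sq ?_ (offNorm_nonneg _)
  rw [offNorm_eq, offNorm_eq, frobenius_norm_sq, frobenius_norm_sq]
  have hent (x y : ι') : offPart (M.submatrix e e) x y = offPart M (e x) (e y) := by
    simp only [offPart_apply, Matrix.submatrix_apply, he.eq_iff]
  simp only [hent]
  have aux (f : ι → ℝ) (hf : ∀ x, 0 ≤ f x) : ∑ x, f (e x) ≤ ∑ x, f x := by
    have := Finset.sum_map Finset.univ ⟨e, he⟩ f
    rw [Function.Embedding.coeFn_mk] at this
    rw [← this]
    exact Finset.sum_le_sum_of_subset_of_nonneg (Finset.subset_univ _) fun x _ _ => hf x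
  calc ∑ x, ∑ y, ‖offPart M (e x) (e y)‖ ^ 2 ≤ ∑ x, ∑ y, ‖offPart M (e x) y‖ ^ 2 :=
        Finset.sum_le_sum fun x _ => aux (fun y => ‖offPart M (e x) y‖ ^ 2) fun _ => by positivity
    _ ≤ _ := aux (fun x => ∑ y, ‖offPart M x y‖ ^ 2) fun _ => by positivity

/-- Let `v` be a left null vector of the second diagonal block and `w` its extension by zero. Then
`w U` lives on the first block, and `w = (w U) Uᴴ` vanishes there. The first diagonal block of `Uᴴ`
being nonsingular, `w U = 0`, so `w = 0`. -/
theorem det_toSquareBlock_snd_ne_zero {κ : Type*} [DecidableEq κ] {c : ι → κ} {p : κ × κ}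
    {U : Matrix ι ι ℂ} (hU : U ∈ Matrix.unitaryGroup ι ℂ) (hs : IsSupportedOn c p U)
    (h : (U.toSquareBlock c p.1).det ≠ 0) : (U.toSquareBlock c p.2).det ≠ 0 := by
  intro h₀
  by_cases hp : p.1 = p.2
  · exact h (hp ▸ h₀)
  obtain ⟨v, hv, hvU⟩ := Matrix.exists_vecMul_eq_zero_iff.2 h₀
  refine hv (funext fun x₀ => ?_)
  -- The row vector `w` is encoded as a matrix with all rows equal to it.
  let W : Matrix ι ι ℂ := Matrix.of fun _ z => if hz : c z = p.2 then v ⟨z, hz⟩ else 0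
  have hW {x z : ι} (hz : c z ≠ p.2) : W x z = 0 := dif_neg hz
  have h₂ (x y : ι) (hy : c y = p.2) : (W * U) x y = 0 := by
    have := congrFun hvU ⟨y, hy⟩
    rw [Pi.zero_apply] at this
    rw [← this, Matrix.mul_apply, Matrix.vecMul, dotProduct,
      ← Finset.sum_subset (Finset.filter_subset (fun z => c z = p.2) _),
      Finset.sum_subtype (p := fun z => c z = p.2) _ (by simp)]
    · exact Finset.sum_congr rfl fun z _ => by
        simp [W, z.2, Matrix.toSquareBlock_def]
    · intro z _ hz
      rw [hW (by simpa using hz), zero_mul]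
  have h₁ (x y : ι) (hy : c y ≠ p.1) : (W * U) x y = 0 := by
    by_cases hy₂ : c y = p.2
    · exact h₂ x y hy₂
    · rw [hs.mul_apply_right W x (fun h => h.elim hy hy₂), hW hy₂]
  have hWU : W * U * Uᴴ = W := by
    rw [Matrix.mul_assoc, show U * Uᴴ = 1 from Matrix.mem_unitaryGroup_iff.1 hU, mul_one]
  have hdet : (Uᴴ.toSquareBlock c p.1).det ≠ 0 := by
    rw [show Uᴴ.toSquareBlock c p.1 = (U.toSquareBlock c p.1)ᴴ from rfl, Matrix.det_conjTranspose]
    exact star_ne_zero.2 h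
  have hzero : W * U = 0 := by
    ext x y
    by_cases hy : c y = p.1
    · refine eq_zero_of_sum_block_eq_zero hdet (w := (W * U) x) (fun z hz => ?_) hy
      have : (W * U * Uᴴ) x z = 0 := by rw [hWU, hW (by rw [hz]; exact hp)]
      rw [← this, Matrix.mul_apply]
      refine Finset.sum_subset (Finset.filter_subset _ _) fun w _ hw => ?_
      rw [h₁ x w (by simpa using hw), zero_mul]
    · exact h₁ x y hy
  have : W x₀ x₀ = 0 := by rw [← hWU, hzero, zero_mul]; rfl
  simpa [W, x₀.2] using this

/-- One step of the process in the limit. -/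
theorem offPart_step {κ : Type*} [DecidableEq κ] {c : ι → κ} {p : κ × κ} {a a' U : Matrix ι ι ℂ}
    (hU : IsBlockRotation c p U) (h : ∀ x y, x ≠ y → a' x y = (Uᴴ * a * U) x y)
    (hp : ∀ x y, x ≠ y → InPair p (c x) → InPair p (c y) → a' x y = 0) :
    offNorm a' ≤ offNorm a ∧ (offNorm a' = offNorm a → RotStep c p (offPart a) (offPart a')) := by
  -- Outside the pivot submatrix, conjugating the diagonal of `a` by `U` yields a diagonal matrix,
  -- so it does not contribute.
  have hdiag : ∀ x y, ¬ (InPair p (c x) ∧ InPair p (c y)) →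
      offPart a' x y = (Uᴴ * offPart a * U) x y := by
    intro x y hxy
    have e : (Uᴴ * offPart a * U) x y = (Uᴴ * a * U) x y -
        (Uᴴ * Matrix.diagonal a.diag * U) x y := by
      rw [← Matrix.sub_apply, offPart, Matrix.mul_sub, Matrix.sub_mul]
    have d : (Uᴴ * Matrix.diagonal a.diag * U) x y = if x = y then a x y else 0 := by
      by_cases hy : InPair p (c y)
      · have hx : ¬ InPair p (c x) := fun hx => hxy ⟨hx, hy⟩
        have hne : x ≠ y := fun h => hx (h ▸ hy)
        rw [if_neg hne, Matrix.mul_assoc, hU.supported.mul_apply_left _ _ hx,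
          Matrix.diagonal_mul, hU.supported x y hxy, Matrix.one_apply_ne hne, mul_zero]
      · rw [hU.supported.mul_apply_right _ _ hy, Matrix.mul_diagonal,
          hU.supported.conjTranspose x y hxy, Matrix.one_apply]
        split_ifs with h
        · rw [one_mul, Matrix.diag_apply, h]
        · rw [zero_mul]
    rw [e, d, offPart_apply]
    split_ifs with hxy'
    · subst hxy'
      have hx : ¬ InPair p (c x) := fun hx => hxy ⟨hx, hx⟩
      rw [hU.supported.conj_apply a hx hx, sub_self]
    · rw [h x y hxy', sub_zero]
  have hzero : ∀ x y, InPair p (c x) ∧ InPair p (c y) → offPart a' x y = 0 := by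
    intro x y hxy
    rw [offPart_apply]
    split_ifs with hne
    · rfl
    · exact hp x y hne hxy.1 hxy.2
  have key := frobenius_norm_zeroing hzero hdiag
  rw [frobenius_norm_unitary_conj hU.unitary] at key
  refine ⟨key.1, fun heq => ?_⟩
  have hM := key.2 heq
  have hEq : offPart a' = Uᴴ * offPart a * U := by
    ext x y
    by_cases hxy : InPair p (c x) ∧ InPair p (c y)
    · rw [hzero x y hxy, hM x y hxy]
    · exact hdiag x y hxy
  refine ⟨U, hU, hEq, ?_, fun x y hx hy => hzero x y ⟨hx, hy⟩⟩
  -- Equal norms make the pivot submatrix vanish after the rotation; rotating back gives the same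
  -- for `offPart a`.
  have := hU.supported.conjTranspose.vanishesOn_conj (S := InPair p) (fun _ h => h)
    (fun x y hx hy => hM x y ⟨hx, hy⟩)
  rwa [Matrix.conjTranspose_conjTranspose, conj_unitary_cancel hU.unitary] at this

end Frobenius

/-- The modulus of the determinant is the product of the singular values. -/
theorem sigmaMin_pow_le_norm_det {p : ℕ} (M : Matrix (Fin p) (Fin p) ℂ) :
    sigmaMin M ^ p ≤ ‖M.det‖ := by
  set f := Matrix.toEuclideanLin M
  have hn : Module.finrank ℂ (EuclideanSpace ℂ (Fin p)) = p := by simp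
  have hdet : f.det = M.det := by
    simp only [f, Matrix.toEuclideanLin_eq_toLin_orthonormal, LinearMap.det_toLin]
  have h₁ : ‖M.det‖ ^ 2 = ∏ i : Fin p, f.singularValues i ^ 2 := by
    have := f.normDet_sq
    rw [f.normDet_eq_norm_det, hdet, f.isSymmetric_adjoint_comp_self.det_eq_prod_eigenvalues hn] at this
    simp only [f.sq_singularValues_fin hn]
    exact_mod_cast this
  have h0 : 0 ≤ sigmaMin M := f.singularValues_nonneg _
  refine le_of_sq_le_sq ?_ (norm_nonneg _)
  rw [h₁, ← pow_mul, mul_comm, pow_mul]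
  calc (sigmaMin M ^ 2) ^ p = ∏ i : Fin p, sigmaMin M ^ 2 := by simp
    _ ≤ _ := Finset.prod_le_prod (fun _ _ => by positivity) fun i _ =>
      pow_le_pow_left₀ h0 (f.singularValues_antitone (by omega)) 2

/-! ### From compositions and iterates to runs, and the limit window. -/

section Iteration

theorem run_of_steps {ι κ : Type*} [Fintype ι] [DecidableEq ι] [DecidableEq κ] {c : ι → κ}
    {d : ℕ → Matrix ι ι ℂ} (O : List (κ × κ)) (s : ℕ)
    (h : ∀ i (hi : i < O.length), RotStep c O[i] (d (s + i)) (d (s + i + 1))) :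
    Run c O (d s) (d (s + O.length)) := by
  induction O generalizing s with
  | nil => rfl
  | cons p O ih =>
    refine ⟨d (s + 1), h 0 (by simp), ?_⟩
    have := ih (s + 1) fun i hi => by
      have := h (i + 1) (by simpa using hi)
      rwa [List.getElem_cons_succ, show s + (i + 1) = s + 1 + i by ring] at this
    rwa [List.length_cons, show s + (O.length + 1) = s + 1 + O.length by ring]

theorem run_replicate_of_runs {ι κ : Type*} [Fintype ι] [DecidableEq ι] [DecidableEq κ]
    {c : ι → κ} {d : ℕ → Matrix ι ι ℂ} {O : List (κ × κ)} (t s : ℕ)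
    (h : ∀ i < t, Run c O (d (s + i * O.length)) (d (s + i * O.length + O.length))) :
    Run c (List.replicate t O).flatten (d s) (d (s + t * O.length)) := by
  induction t generalizing s with
  | zero => simp [Run]
  | succ t ih =>
    rw [List.replicate_succ, List.flatten_cons, run_append]
    refine ⟨d (s + O.length), by simpa using h 0 (by omega), ?_⟩
    have := ih (s + O.length) fun i hi => by
      have := h (i + 1) (by omega)
      rwa [show s + (i + 1) * O.length = s + O.length + i * O.length by ring] at this
    rwa [show s + (t + 1) * O.length = s + O.length + t * O.length by ring]

variable {n : ℕ} {π : Composition n}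

theorem IsElementaryBlock.isSupportedOn {p : Fin π.length × Fin π.length}
    {T : Matrix (Fin n) (Fin n) ℂ} (h : IsElementaryBlock π p T) :
    IsSupportedOn π.index p T := by
  intro x y hxy
  have := congrFun (congrFun (h (π.index x) (π.index y) hxy) (π.invEmbedding x)) (π.invEmbedding y)
  simp only [matBlock, Matrix.submatrix_apply] at this
  rwa [π.embedding_comp_inv x, π.embedding_comp_inv y] at this

theorem index_eq_iff {x : Fin n} {r : Fin π.length} :
    π.index x = r ↔ ∃ i, π.embedding r i = x := by
  constructor
  · rintro rfl
    exact ⟨π.invEmbedding x, π.embedding_comp_inv x⟩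
  · rintro ⟨i, rfl⟩
    exact π.index_embedding r i

theorem det_toSquareBlock_index (U : Matrix (Fin n) (Fin n) ℂ) (r : Fin π.length) :
    (U.toSquareBlock π.index r).det = (matBlock π U r r).det := by
  let f : Fin (π.blocksFun r) → {x // π.index x = r} :=
    fun i => ⟨π.embedding r i, π.index_embedding r i⟩
  have hf : Function.Bijective f := by
    refine ⟨fun i j h => (π.embedding r).injective (congrArg Subtype.val h), fun x => ?_⟩
    obtain ⟨i, hi⟩ := index_eq_iff.1 x.2
    exact ⟨i, Subtype.ext hi⟩
  rw [← Matrix.det_submatrix_equiv_self (Equiv.ofBijective f hf)]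
  rfl

/-- The positions of the pivot submatrix. -/
def pivotIndex (π : Composition n) (p : Fin π.length × Fin π.length) :
    Fin (π.blocksFun p.1) ⊕ Fin (π.blocksFun p.2) → Fin n :=
  Sum.elim (π.embedding p.1) (π.embedding p.2)

theorem pivotSubmatrix_eq (A : Matrix (Fin n) (Fin n) ℂ) (p : Fin π.length × Fin π.length) :
    pivotSubmatrix π A p = A.submatrix (pivotIndex π p) (pivotIndex π p) := by
  ext (i | i) (j | j) <;> rfl

theorem offNorm_pivotSubmatrix_le (A : Matrix (Fin n) (Fin n) ℂ)
    {p : Fin π.length × Fin π.length} (hp : p.1 ≠ p.2) :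
    offNorm (pivotSubmatrix π A p) ≤ offNorm A := by
  rw [pivotSubmatrix_eq]
  refine offNorm_submatrix_le A ?_
  refine (π.embedding p.1).injective.sumElim (π.embedding p.2).injective fun i j h => hp ?_
  rw [← π.index_embedding p.1 i, h, π.index_embedding]

theorem norm_entry_le_offNorm_pivotSubmatrix (A : Matrix (Fin n) (Fin n) ℂ)
    {p : Fin π.length × Fin π.length} {x y : Fin n} (hxy : x ≠ y)
    (hx : InPair p (π.index x)) (hy : InPair p (π.index y)) :
    ‖A x y‖ ≤ offNorm (pivotSubmatrix π A p) := by
  have hex {x : Fin n} (hx : InPair p (π.index x)) : ∃ i, pivotIndex π p i = x := by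
    rcases hx with hx | hx
    · obtain ⟨i, hi⟩ := index_eq_iff.1 hx
      exact ⟨Sum.inl i, hi⟩
    · obtain ⟨i, hi⟩ := index_eq_iff.1 hx
      exact ⟨Sum.inr i, hi⟩
  obtain ⟨i, rfl⟩ := hex hx
  obtain ⟨j, rfl⟩ := hex hy
  have := norm_entry_le_offNorm (pivotSubmatrix π A p) (fun h : i = j => hxy (h ▸ rfl))
  rwa [pivotSubmatrix_eq] at this ⊢

/-- One ultrafilter provides limits of all shifted sequences at once, replacing repeated extraction
of subsequences. -/
theorem exists_tendsto_ultrafilter {E : Type*} [NormedAddCommGroup E] [ProperSpace E]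
    (F : Ultrafilter ℕ) {f : ℕ → E} {C : ℝ} (hf : ∀ k, ‖f k‖ ≤ C) :
    ∃ l, Tendsto f F (𝓝 l) := by
  obtain ⟨l, -, hl⟩ := (isCompact_closedBall (0 : E) C).ultrafilter_le_nhds (F.map f)
    (le_principal_iff.2 (Filter.mem_map.2 (Filter.Eventually.of_forall fun k => by simpa using hf k)))
  exact ⟨l, hl⟩

theorem norm_le_of_mem_unitaryGroup {U : Matrix (Fin n) (Fin n) ℂ}
    (hU : U ∈ Matrix.unitaryGroup (Fin n) ℂ) : ‖U‖ ≤ ‖(1 : Matrix (Fin n) (Fin n) ℂ)‖ := by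
  have : ((‖U‖ ^ 2 : ℝ) : ℂ) = ((‖(1 : Matrix (Fin n) (Fin n) ℂ)‖ ^ 2 : ℝ) : ℂ) := by
    rw [frobenius_norm_sq_eq_trace, frobenius_norm_sq_eq_trace,
      show U * Uᴴ = 1 from Matrix.mem_unitaryGroup_iff.1 hU, Matrix.conjTranspose_one, mul_one]
  exact le_of_sq_le_sq (Complex.ofReal_injective this).le (norm_nonneg _)

theorem exists_pos_eventually_le_of_liminf_pos {u : ℕ → ℝ} (h : 0 < liminf u atTop) :
    ∃ δ > 0, ∀ᶠ k in atTop, δ ≤ u k := by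
  rw [liminf_eq] at h
  have hne : {a | ∀ᶠ k in atTop, a ≤ u k}.Nonempty := by
    by_contra hempty
    -- The real `sSup` of the empty set is `0`, which positivity of the liminf excludes.
    rw [Set.not_nonempty_iff_eq_empty.1 hempty, Real.sSup_empty] at h
    exact lt_irrefl _ h
  obtain ⟨δ, hδ, hpos⟩ := exists_lt_of_lt_csSup hne h
  exact ⟨δ, hpos, hδ⟩

/-- One step of the process in the limit along an ultrafilter along which the pivot pair is
constant. -/
theorem step_of_tendsto {A T E U : ℕ → Matrix (Fin n) (Fin n) ℂ}
    {piv : ℕ → Fin π.length × Fin π.length}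
    (hA : ∀ k, A (k + 1) = (T k)ᴴ * A k * T k + E k)
    (hU : ∀ k, U k ∈ Matrix.unitaryGroup (Fin n) ℂ ∧ IsElementaryBlock π (piv k) (U k))
    (hTU : Tendsto (fun k => T k - U k) atTop (𝓝 0))
    {δ : ℝ} (hδ : 0 < δ)
    (hdet : ∀ᶠ k in atTop, δ ≤ sigmaMin (matBlock π (T k) (piv k).1 (piv k).1))
    (hE : Tendsto (fun k => offNorm (E k)) atTop (𝓝 0))
    (hpiv : Tendsto (fun k => offNorm (pivotSubmatrix π (A (k + 1)) (piv k))) atTop (𝓝 0))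
    {F : Ultrafilter ℕ} {g : ℕ → ℕ} (hg : Tendsto g F atTop)
    {p : Fin π.length × Fin π.length} (hp : ∀ᶠ k in F, piv (g k) = p)
    {a a' : Matrix (Fin n) (Fin n) ℂ} (ha : Tendsto (fun k => A (g k)) F (𝓝 a))
    (ha' : Tendsto (fun k => A (g k + 1)) F (𝓝 a')) :
    offNorm a' ≤ offNorm a ∧
      (offNorm a' = offNorm a → RotStep π.index p (offPart a) (offPart a')) := by
  obtain ⟨u, hu⟩ : ∃ u, Tendsto (fun k => U (g k)) F (𝓝 u) := by
    have : ProperSpace (Matrix (Fin n) (Fin n) ℂ) := FiniteDimensional.proper ℂ _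
    exact exists_tendsto_ultrafilter F fun k => norm_le_of_mem_unitaryGroup (hU (g k)).1
  have hT : Tendsto (fun k => T (g k)) F (𝓝 u) := by
    simpa using (hTU.comp hg).add hu
  have entry {B : ℕ → Matrix (Fin n) (Fin n) ℂ} {b : Matrix (Fin n) (Fin n) ℂ}
      (hB : Tendsto B F (𝓝 b)) (x y : Fin n) : Tendsto (fun k => B k x y) F (𝓝 (b x y)) :=
    ((continuous_apply_apply x y).tendsto b).comp hB
  have hunit : u ∈ Matrix.unitaryGroup (Fin n) ℂ := by
    rw [Matrix.mem_unitaryGroup_iff, Matrix.star_eq_conjTranspose]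
    have h₁ : Tendsto (fun k => U (g k) * (U (g k))ᴴ) F (𝓝 (u * uᴴ)) :=
      hu.mul ((continuous_id.matrix_conjTranspose.tendsto u).comp hu)
    refine tendsto_nhds_unique h₁ (tendsto_const_nhds.congr fun k => ?_)
    exact (Matrix.mem_unitaryGroup_iff.1 (hU (g k)).1).symm
  have hsupp : IsSupportedOn π.index p u := by
    intro x y hxy
    refine tendsto_nhds_unique (entry hu x y) (tendsto_const_nhds.congr' ?_)
    filter_upwards [hp] with k hk
    exact ((hU (g k)).2.isSupportedOn x y (by rwa [hk])).symm
  -- A lower bound on the smallest singular value bounds the determinant below, and this bound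
  -- passes to the limit by continuity.
  have hdet₁ : (u.toSquareBlock π.index p.1).det ≠ 0 := by
    rw [det_toSquareBlock_index]
    have hcont : Continuous fun M : Matrix (Fin n) (Fin n) ℂ => ‖(matBlock π M p.1 p.1).det‖ :=
      (continuous_id.matrix_submatrix _ _).matrix_det.norm
    have : δ ^ π.blocksFun p.1 ≤ ‖(matBlock π u p.1 p.1).det‖ := by
      refine ge_of_tendsto ((hcont.tendsto u).comp hT) ?_
      filter_upwards [hp, hg.eventually hdet] with k hk hk'
      rw [hk] at hk'
      exact (pow_le_pow_left₀ hδ.le hk' _).trans (sigmaMin_pow_le_norm_det _)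
    exact norm_pos_iff.1 ((pow_pos hδ _).trans_le this)
  refine offPart_step ⟨hunit, hsupp, hdet₁, det_toSquareBlock_snd_ne_zero hunit hsupp hdet₁⟩
    (fun x y hxy => ?_) (fun x y hxy hx hy => ?_)
  · have h₁ : Tendsto (fun k => (T (g k))ᴴ * A (g k) * T (g k)) F (𝓝 (uᴴ * a * u)) :=
      (((continuous_id.matrix_conjTranspose.tendsto u).comp hT).mul ha).mul hT
    -- Only off-diagonal entries of `E` are controlled, so the limit recursion is obtained for `x ≠
    -- y` only; `offPart_step` needs no more.
    have h₂ : Tendsto (fun k => E (g k) x y) F (𝓝 0) :=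
      squeeze_zero_norm (fun k => norm_entry_le_offNorm (E (g k)) hxy) (hE.comp hg)
    have h₃ := (entry h₁ x y).add h₂
    rw [add_zero] at h₃
    refine tendsto_nhds_unique (entry ha' x y) (h₃.congr fun k => ?_)
    rw [hA, Matrix.add_apply]
  · refine tendsto_nhds_unique (entry ha' x y) ?_
    refine squeeze_zero_norm' ?_ (hpiv.comp hg)
    filter_upwards [hp] with k hk
    have := norm_entry_le_offNorm_pivotSubmatrix (A (g k + 1)) (p := piv (g k)) hxy
      (by rwa [hk]) (by rwa [hk])
    exact this

theorem IsPivotOrdering.exists_inPair {m : ℕ} {O : List (Fin m × Fin m)} (hO : IsPivotOrdering O)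
    (hne : O ≠ []) (r : Fin m) : ∃ p ∈ O, InPair p r := by
  obtain ⟨q, hq⟩ := List.exists_mem_of_ne_nil O hne
  have hq := (hO.2 q).1 hq
  obtain ⟨r', hr'⟩ : ∃ r', r' ≠ r := by
    by_cases h : q.1 = r
    · exact ⟨q.2, fun h' => hq.ne (h.trans h'.symm)⟩
    · exact ⟨q.1, h⟩
  rcases lt_or_gt_of_ne hr' with h | h
  · exact ⟨(r', r), (hO.2 _).2 h, Or.inr rfl⟩
  · exact ⟨(r, r'), (hO.2 _).2 h, Or.inl rfl⟩

/-- This fixes the phase in the cycle, so that each offset in the window has a constant pivot pair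
along `F`. -/
theorem exists_ultrafilter_eventually_mod_eq (F : Ultrafilter ℕ) (g : ℕ → ℕ) {N : ℕ} (hN : 0 < N) :
    ∃ ρ < N, ∀ᶠ k in F, g k % N = ρ := by
  have := (Ultrafilter.eventually_exists_mem_iff (f := F) (is := Set.Iio N) (Set.finite_Iio N)
    (P := fun ρ k => g k % N = ρ)).1
    (Filter.Eventually.of_forall fun k => ⟨_, Nat.mod_lt _ hN, rfl⟩)
  exact this

theorem offNorm_tendsto_zero {A T E U : ℕ → Matrix (Fin n) (Fin n) ℂ}
    {piv : ℕ → Fin π.length × Fin π.length}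
    (hA : ∀ k, A (k + 1) = (T k)ᴴ * A k * T k + E k)
    {O : List (Fin π.length × Fin π.length)} (hO : IsGeneralizedSerial O)
    (hOpiv : IsCyclicStrategy O piv)
    (hU : ∀ k, U k ∈ Matrix.unitaryGroup (Fin n) ℂ ∧ IsElementaryBlock π (piv k) (U k))
    (hTU : Tendsto (fun k => T k - U k) atTop (𝓝 0))
    {δ : ℝ} (hδ : 0 < δ)
    (hdet : ∀ᶠ k in atTop, δ ≤ sigmaMin (matBlock π (T k) (piv k).1 (piv k).1))
    {C : ℝ} (hC : ∀ k, ‖A k‖ ≤ C)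
    (hE : Tendsto (fun k => offNorm (E k)) atTop (𝓝 0))
    (hpiv : Tendsto (fun k => offNorm (pivotSubmatrix π (A (k + 1)) (piv k))) atTop (𝓝 0)) :
    Tendsto (fun k => offNorm (A k)) atTop (𝓝 0) := by
  have hne : O ≠ [] := by
    rintro rfl
    simpa using hOpiv 0
  set N := O.length with hN
  have hNpos : 0 < N := List.length_pos_iff.2 hne
  obtain ⟨t, ht⟩ := hO.forcesZero (ι := Fin n)
  have hbdd : IsBoundedUnder (· ≤ ·) atTop fun k => offNorm (A k) :=
    isBoundedUnder_of ⟨C, fun k => (offNorm_le_norm _).trans (hC k)⟩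
  have hcobdd : IsCoboundedUnder (· ≤ ·) atTop fun k => offNorm (A k) :=
    (isBoundedUnder_of ⟨0, fun k => offNorm_nonneg _⟩).isCoboundedUnder_le
  set L := limsup (fun k => offNorm (A k)) atTop with hL
  have hlt : ∀ ε > 0, ∀ᶠ k in atTop, offNorm (A k) < L + ε := fun ε hε =>
    eventually_lt_of_limsup_lt (by linarith) hbdd
  suffices hL0 : L = 0 by
    refine tendsto_order.2 ⟨fun x hx => Eventually.of_forall fun k => hx.trans_le (offNorm_nonneg _),
      fun x hx => ?_⟩
    simpa [hL0] using hlt x hx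
  obtain ⟨F, hF, hFL⟩ : ∃ F : Ultrafilter ℕ, (F : Filter ℕ) ≤ atTop ∧
      Tendsto (fun k => offNorm (A k)) F (𝓝 L) := by
    refine mapClusterPt_iff_ultrafilter.1 ?_
    rw [Metric.nhds_basis_ball.mapClusterPt_iff_frequently]
    intro ε hε
    refine ((frequently_lt_of_lt_limsup hcobdd (sub_lt_self L hε)).and_eventually
      (hlt ε hε)).mono fun k hk => ?_
    rw [Metric.mem_ball, Real.dist_eq, abs_lt]
    constructor <;> linarith [hk.1, hk.2]
  -- At most one cycle serves to reach the start of a cycle; `t + 1` full cycles then fit, at least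
  -- one even if `t = 0`, as `hd` requires.
  set W := (t + 2) * N with hW
  have hg (s : ℕ) : Tendsto (fun k => k - W + s) F atTop :=
    ((tendsto_add_atTop_nat s).comp (tendsto_sub_atTop_nat W)).mono_left hF
  have hex (s : ℕ) : ∃ a, Tendsto (fun k => A (k - W + s)) F (𝓝 a) := by
    have : ProperSpace (Matrix (Fin n) (Fin n) ℂ) := FiniteDimensional.proper ℂ _
    exact exists_tendsto_ultrafilter F fun k => hC _
  choose a ha using hex
  obtain ⟨ρ, hρ, hρF⟩ := exists_ultrafilter_eventually_mod_eq F (fun k => k - W) hNpos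
  have hstep (s : ℕ) {p} (hp : O[(ρ + s) % N]? = some p) :=
    step_of_tendsto hA hU hTU hδ hdet hE hpiv (hg s) (p := p)
      (by
        filter_upwards [hρF] with k hk
        have := hOpiv (k - W + s)
        rw [← hN, Nat.add_mod, hk, Nat.add_mod_mod, hp] at this
        exact (Option.some.inj this).symm)
      (ha s) (ha (s + 1))
  have hsome (s : ℕ) : ∃ p, O[(ρ + s) % N]? = some p :=
    ⟨_, List.getElem?_eq_getElem (Nat.mod_lt _ hNpos)⟩
  have hanti : Antitone fun s => offNorm (a s) := antitone_nat_of_succ_le fun s => by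
    obtain ⟨p, hp⟩ := hsome s
    exact (hstep s hp).1
  have hlim (s : ℕ) : Tendsto (fun k => offNorm (A (k - W + s))) F (𝓝 (offNorm (a s))) :=
    (continuous_offNorm.tendsto _).comp (ha s)
  have hle (s : ℕ) : offNorm (a s) ≤ L := le_of_forall_pos_le_add fun ε hε =>
    le_of_tendsto (hlim s) (((hg s).eventually (hlt ε hε)).mono fun _ h => h.le)
  have hWL : offNorm (a W) = L := by
    refine tendsto_nhds_unique (hlim W) (hFL.congr' ?_)
    filter_upwards [hF (eventually_ge_atTop W)] with k hk
    rw [Nat.sub_add_cancel hk]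
  -- The off-norms decrease in `s`, never exceed `L`, and equal `L` at the end of the window.
  have heq (s : ℕ) (hs : s ≤ W) : offNorm (a s) = L :=
    le_antisymm (hle s) (hWL ▸ hanti hs)
  -- Since `ρ + s₀ = N`, offset `s₀` is the start of a cycle.
  set s₀ := N - ρ with hs₀
  have hrun (i : ℕ) (hi : i ≤ t) : Run π.index O (offPart (a (s₀ + i * N)))
      (offPart (a (s₀ + i * N + N))) := by
    refine run_of_steps (d := fun s => offPart (a s)) O (s₀ + i * N) fun j hj => ?_
    have hj : j < N := hj
    have hmul : i * N ≤ t * N := Nat.mul_le_mul_right N hi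
    have hW' : W = t * N + 2 * N := by rw [hW]; ring
    refine (hstep (s₀ + i * N + j) ?_).2 ?_
    · rw [show ρ + (s₀ + i * N + j) = j + (i + 1) * N by
        rw [add_mul, one_mul]; omega, Nat.add_mul_mod_self_right, Nat.mod_eq_of_lt hj]
      exact List.getElem?_eq_getElem hj
    · rw [heq _ (by omega), heq _ (by omega)]
  -- `offPart` removes only diagonal entries; whole diagonal blocks vanish because every block index
  -- occurs in some pivot pair of the cycle.
  have hd : DiagBlocksVanish π.index (offPart (a s₀)) := fun x y hxy => by
    have := hrun 0 (Nat.zero_le _)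
    simp only [zero_mul, add_zero] at this
    exact this.diagBlock_eq_zero (hO.1.exists_inPair hne _) hxy rfl
  have hzero : offPart (a s₀) = 0 := ht π.index _ _ hd
    (run_replicate_of_runs (d := fun s => offPart (a s)) t s₀ fun i hi => hrun i hi.le)
  have hs₀W : s₀ ≤ W := by
    have : W = t * N + 2 * N := by rw [hW]; ring
    omega
  rw [← heq s₀ hs₀W, offNorm_eq, hzero, norm_zero]

end Iteration

theorem mainTheorem9 {n : ℕ} (π : Composition n)
    (A T E : ℕ → Matrix (Fin n) (Fin n) ℂ) (piv : ℕ → Fin π.length × Fin π.length)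
    -- the starting matrix
    (hA_herm : (A 0).IsHermitian) (hA_ne : A 0 ≠ 0)
    -- the process, with nonsingular elementary block matrices
    (hT_elem : ∀ k, IsElementaryBlock π (piv k) (T k))
    (hT_unit : ∀ k, IsUnit (T k))
    (hA : ∀ k, A (k + 1) = (T k)ᴴ * A k * T k + E k)
    -- A1
    (hA1 : ∃ O : List (Fin π.length × Fin π.length),
      IsGeneralizedSerial O ∧ IsCyclicStrategy O piv)
    -- A2
    (hA2 : ∃ U : ℕ → Matrix (Fin n) (Fin n) ℂ,
      (∀ k, U k ∈ Matrix.unitaryGroup (Fin n) ℂ ∧ IsElementaryBlock π (piv k) (U k)) ∧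
        Tendsto (fun k => T k - U k) atTop (𝓝 0))
    -- A3
    (hA3 : 0 < liminf (fun k => sigmaMin (matBlock π (T k) (piv k).1 (piv k).1)) atTop)
    -- boundedness of the iterates and decay of the perturbations
    (hA_bdd : ∃ C : ℝ, ∀ k, ‖A k‖ ≤ C)
    (hE : Tendsto (fun k => offNorm (E k)) atTop (𝓝 0)) :
    Tendsto (fun k => offNorm (pivotSubmatrix π (A (k + 1)) (piv k))) atTop (𝓝 0) ↔
      Tendsto (fun k => offNorm (A k)) atTop (𝓝 0) := by
  obtain ⟨O, hO, hOpiv⟩ := hA1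
  obtain ⟨U, hU, hTU⟩ := hA2
  obtain ⟨C, hC⟩ := hA_bdd
  obtain ⟨δ, hδ, hdet⟩ := exists_pos_eventually_le_of_liminf_pos hA3
  refine ⟨offNorm_tendsto_zero hA hO hOpiv hU hTU hδ hdet hC hE, fun h => ?_⟩
  -- Conversely, as `i(k) ≠ j(k)`, the pivot submatrix is a principal submatrix of `A (k + 1)`, so
  -- its off-norm is no larger.
  refine squeeze_zero (fun k => offNorm_nonneg _) (fun k => ?_) (h.comp (tendsto_add_atTop_nat 1))
  have hmem : piv k ∈ O := List.mem_of_getElem? (hOpiv k)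
  exact offNorm_pivotSubmatrix_le (A (k + 1)) ((hO.1.2 _).1 hmem).ne
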